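/- An incidence matrix is a matrix with entries in $\{0,1\}$, of any finite size, that has no zero row and no zero column. For $n\ge 0$, let $F_{1111}(n)$ be the number of incidence matrices with exactly $n$ ones, and let $F_{1011}(n)$ be the number of incidence matrices with exactly $n$ ones in which no two rows are equal; in both counts the numbers of rows and columns are not fixed in advance, and matrices that differ by a permutation of rows or columns are counted as different. Then $$F_{1011}(n)=o\left(F_{1111}(n)\right)\qquad\text{as } n\to\infty,$$ that is, $\lim_{n\to\infty} F_{1011}(n)/F_{1111}(n)=0$. -/

import Mathlib

open Filter Asymptotics

/-- A zero-one matrix with `k` rows and `l` columns. -/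
abbrev ZeroOneMatrix (k l : ℕ) : Type := Matrix (Fin k) (Fin l) (Fin 2)

/-- The number of ones of a zero-one matrix. -/
def numOnes {k l : ℕ} (A : ZeroOneMatrix k l) : ℕ :=
  (Finset.univ.filter fun p : Fin k × Fin l => A p.1 p.2 = 1).card

/-- An incidence matrix: a zero-one matrix with no zero row and no zero column. -/
def IsIncidenceMatrix {k l : ℕ} (A : ZeroOneMatrix k l) : Prop :=
  (∀ i, ∃ j, A i j = 1) ∧ (∀ j, ∃ i, A i j = 1)

/-- No two distinct rows of the matrix are equal. -/
def NoRepeatedRows {k l : ℕ} (A : ZeroOneMatrix k l) : Prop :=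
  ∀ i i' : Fin k, i ≠ i' → A i ≠ A i'

/-- The set of all incidence matrices, of any size, with exactly `n` ones. -/
def incidenceMatrices (n : ℕ) : Set (Σ k l : ℕ, ZeroOneMatrix k l) :=
  {M | IsIncidenceMatrix M.2.2 ∧ numOnes M.2.2 = n}

/-- The set of all incidence matrices, of any size, with exactly `n` ones and no repeated rows. -/
def incidenceMatricesNoRepeatedRows (n : ℕ) : Set (Σ k l : ℕ, ZeroOneMatrix k l) :=
  {M | M ∈ incidenceMatrices n ∧ NoRepeatedRows M.2.2}

/-- `F₁₁₁₁(n)`: the number of incidence matrices with `n` ones. -/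
noncomputable def F1111 (n : ℕ) : ℕ := (incidenceMatrices n).ncard

/-- `F₁₀₁₁(n)`: the number of incidence matrices with `n` ones and no repeated rows. -/
noncomputable def F1011 (n : ℕ) : ℕ := (incidenceMatricesNoRepeatedRows n).ncard

/-- An incidence matrix has at most as many rows as ones. -/
theorem IsIncidenceMatrix.rows_le {k l : ℕ} {A : ZeroOneMatrix k l} (h : IsIncidenceMatrix A) :
    k ≤ numOnes A := by
  choose f hf using h.1
  have := Finset.card_le_card_of_injOn (s := (Finset.univ : Finset (Fin k)))
    (t := Finset.univ.filter fun p : Fin k × Fin l => A p.1 p.2 = 1) (fun i => (i, f i))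
    (fun i _ => by simp [hf i]) (fun i _ j _ hij => (Prod.ext_iff.1 hij).1)
  simpa [numOnes] using this

/-- An incidence matrix has at most as many columns as ones. -/
theorem IsIncidenceMatrix.cols_le {k l : ℕ} {A : ZeroOneMatrix k l} (h : IsIncidenceMatrix A) :
    l ≤ numOnes A := by
  choose f hf using h.2
  have := Finset.card_le_card_of_injOn (s := (Finset.univ : Finset (Fin l)))
    (t := Finset.univ.filter fun p : Fin k × Fin l => A p.1 p.2 = 1) (fun j => (f j, j))
    (fun i _ => by simp [hf i]) (fun i _ j _ hij => (Prod.ext_iff.1 hij).2)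
  simpa [numOnes] using this

/-- There are finitely many incidence matrices with `n` ones, so that `F1111` and `F1011` are
genuine cardinalities. -/
theorem incidenceMatrices_finite (n : ℕ) : (incidenceMatrices n).Finite := by
  refine (Set.finite_range fun M : Σ (k l : Fin (n + 1)), ZeroOneMatrix k l =>
    (⟨M.1, M.2.1, M.2.2⟩ : Σ k l : ℕ, ZeroOneMatrix k l)).subset ?_
  rintro ⟨k, l, A⟩ ⟨hA, hn⟩
  have hk : k < n + 1 := Nat.lt_succ_of_le (hn ▸ hA.rows_le)
  have hl : l < n + 1 := Nat.lt_succ_of_le (hn ▸ hA.cols_le)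
  exact ⟨⟨⟨k, hk⟩, ⟨l, hl⟩, A⟩, rfl⟩

/-! Encode a matrix by its row supports and separate the matrices with distinct rows by a threshold
`m` on the number of singleton rows (rows with a single one).

With at most `m` singletons, at least `n - m` ones lie in larger rows. Moving such a one into a new
singleton row, inserted anywhere, is undone by marking one of at most `m + 2` singletons and one
other row. Hence these matrices make up at most a fraction `(m + 2) / (n - m)` of all
(`card_few_singletonRows_mul_le`).

With more than `m` singletons and distinct rows, overwrite one singleton row by another, in at least
`(m + 1) * m` ways. The result has only one repeated pair, so the overwritten row is known up to two
choices and its lost one up to the choice of a column. A column left empty is deleted. The fraction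
is at most `4 * n / ((m + 1) * m)` (`card_many_singletonRows_mul_le`).

Taking `m` about `n / K`, the sum is at most `2 / K + O(K ^ 2 / n)`, which is small for `K` fixed
and large and `n → ∞`. -/

/-- The families of `k` nonempty subsets of `Fin l` covering `Fin l`, with cardinalities adding up
to `n`. They are the row supports of incidence matrices. -/
def coverFamilies (k l n : ℕ) : Finset (Fin k → Finset (Fin l)) :=
  Finset.univ.filter fun A => (∀ i, (A i).Nonempty) ∧ (∀ j, ∃ i, j ∈ A i) ∧ ∑ i, (A i).card = n

/-- The indices of the singletons in a family of sets. -/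
def singletonRows {k l : ℕ} (A : Fin k → Finset (Fin l)) : Finset (Fin k) :=
  Finset.univ.filter fun i => (A i).card = 1

theorem mem_coverFamilies {k l n : ℕ} {A : Fin k → Finset (Fin l)} :
    A ∈ coverFamilies k l n ↔
      (∀ i, (A i).Nonempty) ∧ (∀ j, ∃ i, j ∈ A i) ∧ ∑ i, (A i).card = n := by
  simp [coverFamilies]

theorem mem_singletonRows {k l : ℕ} {A : Fin k → Finset (Fin l)} {i : Fin k} :
    i ∈ singletonRows A ↔ (A i).card = 1 := by
  simp [singletonRows]

/-! ### Few singletons: splitting off a one -/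

/-- The elements of the members of a family that are not singletons. -/
def splittableOnes {k l : ℕ} (A : Fin k → Finset (Fin l)) : Finset (Σ _ : Fin k, Fin l) :=
  (Finset.univ \ singletonRows A).sigma A

theorem card_splittableOnes_add {k l n : ℕ} {A : Fin k → Finset (Fin l)}
    (hA : A ∈ coverFamilies k l n) :
    (splittableOnes A).card + (singletonRows A).card = n := by
  have h1 : ∑ i ∈ singletonRows A, (A i).card = (singletonRows A).card := by
    rw [Finset.card_eq_sum_ones]
    exact Finset.sum_congr rfl fun i hi => mem_singletonRows.1 hi
  rw [splittableOnes, Finset.card_sigma, ← h1, Finset.sum_sdiff (Finset.subset_univ _)]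
  exact (mem_coverFamilies.1 hA).2.2

/-- Split the element `j` off the member `i` of a family, as a new member with index `p`. -/
def splitOff {k l : ℕ} (A : Fin k → Finset (Fin l)) (i : Fin k) (j : Fin l) (p : Fin (k + 1)) :
    Fin (k + 1) → Finset (Fin l) :=
  Fin.insertNth (α := fun _ => Finset (Fin l)) p {j} (Function.update A i ((A i).erase j))

theorem splitOff_mem {k l n : ℕ} {A : Fin k → Finset (Fin l)} (hA : A ∈ coverFamilies k l n)
    {i : Fin k} {j : Fin l} (hij : ⟨i, j⟩ ∈ splittableOnes A) (p : Fin (k + 1)) :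
    splitOff A i j p ∈ coverFamilies (k + 1) l n := by
  obtain ⟨h1, h2, h3⟩ := mem_coverFamilies.1 hA
  simp only [splittableOnes, Finset.mem_sigma, Finset.mem_sdiff, Finset.mem_univ, true_and,
    mem_singletonRows] at hij
  obtain ⟨hi, hj⟩ := hij
  have hpos := Finset.card_pos.2 (h1 i)
  have hcard := Finset.card_erase_of_mem hj
  refine mem_coverFamilies.2 ⟨?_, ?_, ?_⟩
  · intro q
    rcases Fin.eq_self_or_eq_succAbove p q with rfl | ⟨q, rfl⟩
    · simp [splitOff]
    · rcases eq_or_ne q i with rfl | hq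
      · simp only [splitOff, Fin.insertNth_apply_succAbove, Function.update_self]
        exact Finset.card_pos.1 (by omega)
      · simpa [splitOff, hq] using h1 q
  · intro c
    rcases eq_or_ne c j with rfl | hc
    · exact ⟨p, by simp [splitOff]⟩
    · obtain ⟨q, hq⟩ := h2 c
      refine ⟨p.succAbove q, ?_⟩
      rcases eq_or_ne q i with rfl | hqi
      · simp [splitOff, hc, hq]
      · simpa [splitOff, hqi] using hq
  · rw [Fin.sum_univ_succAbove _ p]
    simp only [splitOff, Fin.insertNth_apply_same, Fin.insertNth_apply_succAbove,
      Finset.card_singleton]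
    rw [← h3, ← Finset.add_sum_erase _ _ (Finset.mem_univ i),
      ← Finset.add_sum_erase (a := i) _ (fun i => (A i).card) (Finset.mem_univ i),
      Function.update_self,
      Finset.sum_congr rfl fun q hq => by rw [Function.update_of_ne (Finset.ne_of_mem_erase hq)]]
    omega

/-- Only the new row and the shortened row `i` can become singletons; all other rows are unchanged.
-/
theorem card_singletonRows_splitOff_le {k l : ℕ} (A : Fin k → Finset (Fin l)) (i : Fin k)
    (j : Fin l) (p : Fin (k + 1)) :
    (singletonRows (splitOff A i j p)).card ≤ (singletonRows A).card + 2 := by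
  have hsub : singletonRows (splitOff A i j p) ⊆
      insert p (insert (p.succAbove i) ((singletonRows A).image p.succAbove)) := by
    intro q hq
    rcases Fin.eq_self_or_eq_succAbove p q with rfl | ⟨q, rfl⟩
    · simp
    · rcases eq_or_ne q i with rfl | hqi
      · simp
      · have : q ∈ singletonRows A := by
          simpa [mem_singletonRows, splitOff, hqi] using hq
        simp [this]
  have h1 := Finset.card_le_card hsub
  have h2 := Finset.card_insert_le p (insert (p.succAbove i) ((singletonRows A).image p.succAbove))
  have h3 := Finset.card_insert_le (p.succAbove i) ((singletonRows A).image p.succAbove)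
  have h4 := Finset.card_image_le (s := singletonRows A) (f := p.succAbove)
  omega

/-- Row `p` reveals `j`, and putting `j` back into row `i` restores the family. -/
theorem splitOff_injective {k l : ℕ} {A A' : Fin k → Finset (Fin l)} {i : Fin k} {j j' : Fin l}
    {p : Fin (k + 1)} (hj : j ∈ A i) (hj' : j' ∈ A' i)
    (h : splitOff A i j p = splitOff A' i j' p) : A = A' ∧ j = j' := by
  have hjj : j = j' := by
    have := congrFun h p
    simpa [splitOff] using this
  subst hjj
  refine ⟨funext fun q => ?_, rfl⟩
  have hq := congrFun h (p.succAbove q)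
  simp only [splitOff, Fin.insertNth_apply_succAbove] at hq
  rcases eq_or_ne q i with rfl | hqi
  · simp only [Function.update_self] at hq
    rw [← Finset.insert_erase hj, hq, Finset.insert_erase hj']
  · simpa [hqi] using hq

/-- Double counting of splittings: a source family has at least `(n - m) * (k + 1)` of them, and a
target arises from at most `(m + 2) * k`, by the choices of `p` and `i`. -/
theorem card_few_singletonRows_mul_le (k l n m : ℕ) :
    ((coverFamilies k l n).filter fun A => (singletonRows A).card ≤ m).card * (n - m) ≤
      (m + 2) * (coverFamilies (k + 1) l n).card := by
  set S := (coverFamilies k l n).filter fun A => (singletonRows A).card ≤ m with hS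
  set T := (coverFamilies (k + 1) l n).filter fun B => (singletonRows B).card ≤ m + 2 with hT
  let X := S.sigma fun A => splittableOnes A ×ˢ (Finset.univ : Finset (Fin (k + 1)))
  let Y := T.sigma fun B => singletonRows B ×ˢ (Finset.univ : Finset (Fin k))
  have hXY : X.card ≤ Y.card := by
    refine Finset.card_le_card_of_injOn
      (fun x => ⟨splitOff x.1 x.2.1.1 x.2.1.2 x.2.2, x.2.2, x.2.1.1⟩) ?_ ?_
    · rintro ⟨A, ⟨i, j⟩, p⟩ hx
      simp only [X, S, Finset.mem_coe, Finset.mem_sigma, Finset.mem_filter, Finset.mem_product,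
        Finset.mem_univ, and_true] at hx
      have := card_singletonRows_splitOff_le A i j p
      simp only [Y, T, Finset.mem_coe, Finset.mem_sigma, Finset.mem_filter, Finset.mem_product,
        Finset.mem_univ, and_true]
      refine ⟨⟨splitOff_mem hx.1.1 hx.2 p, by omega⟩, ?_⟩
      simp [mem_singletonRows, splitOff]
    · rintro ⟨A, ⟨i, j⟩, p⟩ hx ⟨A', ⟨i', j'⟩, p'⟩ hx' h
      simp only [X, splittableOnes, Finset.mem_coe, Finset.mem_sigma, Finset.mem_product] at hx hx'
      simp only [Sigma.mk.injEq, heq_eq_eq, Prod.mk.injEq] at h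
      obtain ⟨h, rfl, rfl⟩ := h
      obtain ⟨rfl, rfl⟩ := splitOff_injective hx.2.1.2 hx'.2.1.2 h
      rfl
  have hX : S.card * ((n - m) * (k + 1)) ≤ X.card := by
    rw [Finset.card_sigma]
    refine Finset.card_nsmul_le_sum _ _ _ fun A hA => ?_
    rw [Finset.card_product, Finset.card_univ, Fintype.card_fin]
    rw [hS, Finset.mem_filter] at hA
    have := card_splittableOnes_add hA.1
    exact Nat.mul_le_mul_right _ (by omega)
  have hY : Y.card ≤ T.card * ((m + 2) * k) := by
    rw [Finset.card_sigma]
    refine Finset.sum_le_card_nsmul _ _ _ fun B hB => ?_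
    rw [Finset.card_product, Finset.card_univ, Fintype.card_fin]
    exact Nat.mul_le_mul_right _ (Finset.mem_filter.1 hB).2
  have hTle : T.card ≤ (coverFamilies (k + 1) l n).card := Finset.card_filter_le _ _
  -- The `k + 1` insertion positions cancel against the `k` choices of the shortened row.
  refine Nat.le_of_mul_le_mul_right (c := k + 1) ?_ k.succ_pos
  calc S.card * (n - m) * (k + 1) = S.card * ((n - m) * (k + 1)) := by ring
    _ ≤ T.card * ((m + 2) * k) := hX.trans (hXY.trans hY)
    _ ≤ (coverFamilies (k + 1) l n).card * ((m + 2) * (k + 1)) := by gcongr; omega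
    _ = _ := by ring

/-! ### Many singletons: overwriting one by another -/

/-- The indices of the members of a family that occur at least twice. -/
def repeatedRows {k l : ℕ} (B : Fin k → Finset (Fin l)) : Finset (Fin k) :=
  Finset.univ.filter fun r => ∃ s, s ≠ r ∧ B s = B r

/-- Changing one member of a family of distinct sets makes at most two members repeated. -/
theorem card_repeatedRows_le_two {k l l' : ℕ} {A : Fin k → Finset (Fin l)}
    (hA : Function.Injective A) {B : Fin k → Finset (Fin l')} {r r' : Fin k}
    (hB : ∀ s t, s ≠ r → t ≠ r → B s = B t → A s = A t) (hr : r' ≠ r) (hBr : B r = B r') :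
    (repeatedRows B).card ≤ 2 := by
  have hsub : repeatedRows B ⊆ {r, r'} := by
    intro s hs
    obtain ⟨t, hts, ht⟩ := (Finset.mem_filter.1 hs).2
    rw [Finset.mem_insert, Finset.mem_singleton]
    -- Take `s` repeated outside `{r, r'}`. If its twin is `r`, then `s` and `r'` already agree in
    -- `A`; otherwise `s` and its twin do. Both contradict injectivity.
    by_contra! hne
    rcases eq_or_ne t r with rfl | htr
    · exact hne.2 (hA (hB s r' hne.1 hr (ht.symm.trans hBr)))
    · exact hts (hA (hB t s htr hne.1 ht))
  exact (Finset.card_le_card hsub).trans Finset.card_le_two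

/-- The families of distinct sets covering `Fin l` with more than `m` singletons. -/
def manySingletonFamilies (k l n m : ℕ) : Finset (Fin k → Finset (Fin l)) :=
  (coverFamilies k l n).filter fun A => Function.Injective A ∧ m < (singletonRows A).card

/-- The families together with a repeated member, where at most two members are repeated. -/
def markedRepeats (k l n : ℕ) : Finset (Σ _ : Fin k → Finset (Fin l), Fin k) :=
  ((coverFamilies k l n).filter fun B => (repeatedRows B).card ≤ 2).sigma repeatedRows

theorem card_markedRepeats_le (k l n : ℕ) :
    (markedRepeats k l n).card ≤ (coverFamilies k l n).card * 2 := by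
  rw [markedRepeats, Finset.card_sigma]
  refine (Finset.sum_le_card_nsmul _ _ 2 fun B hB => (Finset.mem_filter.1 hB).2).trans ?_
  exact Nat.mul_le_mul_right _ (Finset.card_filter_le _ _)

/-- The families of distinct sets with an ordered pair of singletons. -/
def markedSingletonPairs (k l n m : ℕ) :
    Finset (Σ _ : Fin k → Finset (Fin l), Fin k × Fin k) :=
  (manySingletonFamilies k l n m).sigma fun A => (singletonRows A).offDiag

theorem mem_markedSingletonPairs {k l n m : ℕ} {A : Fin k → Finset (Fin l)} {r r' : Fin k} :
    (⟨A, r, r'⟩ : Σ _ : Fin k → Finset (Fin l), Fin k × Fin k) ∈ markedSingletonPairs k l n m ↔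
      A ∈ coverFamilies k l n ∧ Function.Injective A ∧ m < (singletonRows A).card ∧
        (A r).card = 1 ∧ (A r').card = 1 ∧ r ≠ r' := by
  simp only [markedSingletonPairs, manySingletonFamilies, Finset.mem_sigma, Finset.mem_filter,
    Finset.mem_offDiag, mem_singletonRows]
  tauto

theorem card_manySingletonFamilies_mul_le (k l n m : ℕ) :
    (manySingletonFamilies k l n m).card * ((m + 1) * m) ≤ (markedSingletonPairs k l n m).card := by
  rw [markedSingletonPairs, Finset.card_sigma]
  refine Finset.card_nsmul_le_sum _ _ _ fun A hA => ?_
  have hA := (Finset.mem_filter.1 hA).2.2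
  rw [Finset.offDiag_card]
  obtain ⟨c, hc⟩ := Nat.exists_eq_add_of_le hA
  rw [hc, ← Nat.mul_sub_one]
  exact Nat.mul_le_mul (by omega) (by omega)

/-- Replace member `r` by member `r'` in a family. -/
def copyRow {k l : ℕ} (A : Fin k → Finset (Fin l)) (r r' : Fin k) : Fin k → Finset (Fin l) :=
  Function.update A r (A r')

theorem sum_card_copyRow {k l : ℕ} {A : Fin k → Finset (Fin l)} {r r' : Fin k}
    (h : (A r).card = (A r').card) : ∑ i, (copyRow A r r' i).card = ∑ i, (A i).card := by
  refine Finset.sum_congr rfl fun i _ => ?_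
  rcases eq_or_ne i r with rfl | hi
  · simp [copyRow, h]
  · simp [copyRow, hi]

/-- Only row `r` is lost, and `hr` supplies it; the source of the copy is then identified by its
value, since rows are distinct. -/
theorem eq_of_copyRow_eq {k l : ℕ} {A A' : Fin k → Finset (Fin l)} {r s s' : Fin k}
    (hA : Function.Injective A) (hs : r ≠ s) (hs' : r ≠ s') (hr : A r = A' r)
    (h : copyRow A r s = copyRow A' r s') : A = A' ∧ s = s' := by
  have hAA : A = A' := by
    funext i
    rcases eq_or_ne i r with rfl | hi
    · exact hr
    · simpa [copyRow, hi] using congrFun h i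
  subst hAA
  exact ⟨rfl, hA (by simpa [copyRow] using congrFun h r)⟩

/-- Member `r` of the family is contained in the union of the other ones. -/
def RowCovered {k l : ℕ} (A : Fin k → Finset (Fin l)) (r : Fin k) : Prop :=
  ∀ j ∈ A r, ∃ i, i ≠ r ∧ j ∈ A i

/-- `RowCovered` ensures that erasing row `r` leaves no column empty. -/
theorem copyRow_mem_markedRepeats {k l n : ℕ} {A : Fin k → Finset (Fin l)}
    (hA : A ∈ coverFamilies k l n) (hinj : Function.Injective A) {r r' : Fin k}
    (hr : (A r).card = 1) (hr' : (A r').card = 1) (hne : r ≠ r') (hcov : RowCovered A r) :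
    (⟨copyRow A r r', r⟩ : Σ _ : Fin k → Finset (Fin l), Fin k) ∈ markedRepeats k l n := by
  obtain ⟨h1, h2, h3⟩ := mem_coverFamilies.1 hA
  have heq : copyRow A r r' r = copyRow A r r' r' := by simp [copyRow, hne.symm]
  simp only [markedRepeats, Finset.mem_sigma, Finset.mem_filter]
  refine ⟨⟨mem_coverFamilies.2 ⟨?_, ?_, ?_⟩, ?_⟩, ?_⟩
  · intro i
    rcases eq_or_ne i r with rfl | hi
    · simpa [copyRow] using h1 r'
    · simpa [copyRow, hi] using h1 i
  · intro j
    obtain ⟨i, hi⟩ := h2 j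
    rcases eq_or_ne i r with rfl | hir
    · obtain ⟨i', hi', hj⟩ := hcov j hi
      exact ⟨i', by simpa [copyRow, hi'] using hj⟩
    · exact ⟨i, by simpa [copyRow, hir] using hi⟩
  · rw [sum_card_copyRow (hr.trans hr'.symm), h3]
  · refine card_repeatedRows_le_two hinj (r := r) (r' := r') ?_ hne.symm heq
    intro s t hs ht h
    simpa [copyRow, hs, ht] using h
  · exact Finset.mem_filter.2 ⟨Finset.mem_univ _, r', hne.symm, heq.symm⟩

/-- Remove the point `j` from the ground set of a family. -/
def deleteColumn {k l : ℕ} (j : Fin (l + 1)) (A : Fin k → Finset (Fin (l + 1))) :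
    Fin k → Finset (Fin l) :=
  fun i => Finset.univ.filter fun c => j.succAbove c ∈ A i

theorem map_deleteColumn {k l : ℕ} {j : Fin (l + 1)} {A : Fin k → Finset (Fin (l + 1))} {i : Fin k}
    (h : j ∉ A i) : (deleteColumn j A i).map j.succAboveEmb = A i := by
  ext c
  simp only [deleteColumn, Finset.mem_map, Finset.mem_filter, Finset.mem_univ, true_and,
    Fin.succAboveEmb_apply]
  constructor
  · rintro ⟨a, ha, rfl⟩
    exact ha
  · intro hc
    obtain ⟨a, rfl⟩ := Fin.exists_succAbove_eq (x := c) (y := j) (by rintro rfl; exact h hc)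
    exact ⟨a, hc, rfl⟩

theorem deleteColumn_injective {k l : ℕ} {j : Fin (l + 1)} {A A' : Fin k → Finset (Fin (l + 1))}
    {i i' : Fin k} (h : j ∉ A i) (h' : j ∉ A' i') (heq : deleteColumn j A i = deleteColumn j A' i') :
    A i = A' i' := by
  rw [← map_deleteColumn h, heq, map_deleteColumn h']

theorem notMem_copyRow {k l : ℕ} {A : Fin k → Finset (Fin l)} {r r' : Fin k} {j : Fin l}
    (hne : r ≠ r') (hj : ∀ i, i ≠ r → j ∉ A i) (i : Fin k) : j ∉ copyRow A r r' i := by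
  rcases eq_or_ne i r with rfl | hi
  · simpa [copyRow] using hj r' hne.symm
  · simpa [copyRow, hi] using hj i hi

/-- Overwriting row `r` empties column `j`, so deleting that column changes no cardinality and no
equality between rows. -/
theorem deleteColumn_copyRow_mem_markedRepeats {k l n : ℕ} {A : Fin k → Finset (Fin (l + 1))}
    (hA : A ∈ coverFamilies k (l + 1) n) (hinj : Function.Injective A) {r r' : Fin k}
    {j : Fin (l + 1)} (hr : A r = {j}) (hr' : (A r').card = 1) (hne : r ≠ r')
    (hj : ∀ i, i ≠ r → j ∉ A i) :
    (⟨deleteColumn j (copyRow A r r'), r⟩ : Σ _ : Fin k → Finset (Fin l), Fin k) ∈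
      markedRepeats k l n := by
  obtain ⟨h1, h2, h3⟩ := mem_coverFamilies.1 hA
  have hnot := notMem_copyRow hne hj
  have hcard : ∀ i, (deleteColumn j (copyRow A r r') i).card = (copyRow A r r' i).card := fun i => by
    rw [← Finset.card_map j.succAboveEmb, map_deleteColumn (hnot i)]
  have heq : deleteColumn j (copyRow A r r') r = deleteColumn j (copyRow A r r') r' := by
    simp [deleteColumn, copyRow, hne.symm]
  simp only [markedRepeats, Finset.mem_sigma, Finset.mem_filter]
  refine ⟨⟨mem_coverFamilies.2 ⟨?_, ?_, ?_⟩, ?_⟩, ?_⟩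
  · intro i
    rw [← Finset.card_pos, hcard, Finset.card_pos]
    rcases eq_or_ne i r with rfl | hi
    · simpa [copyRow] using h1 r'
    · simpa [copyRow, hi] using h1 i
  · intro c
    obtain ⟨i, hi⟩ := h2 (j.succAbove c)
    have hir : i ≠ r := by
      rintro rfl
      rw [hr, Finset.mem_singleton] at hi
      exact Fin.succAbove_ne j c hi
    exact ⟨i, by simpa [deleteColumn, copyRow, hir] using hi⟩
  · rw [Finset.sum_congr rfl fun i _ => hcard i, sum_card_copyRow (by simp [hr, hr']), h3]
  · refine card_repeatedRows_le_two hinj (r := r) (r' := r') ?_ hne.symm heq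
    intro s t hs ht h
    simpa [copyRow, hs, ht] using deleteColumn_injective (hnot s) (hnot t) h
  · exact Finset.mem_filter.2 ⟨Finset.mem_univ _, r', hne.symm, heq.symm⟩

open Classical in
theorem card_covered_markedSingletonPairs_le (k l n m : ℕ) :
    ((markedSingletonPairs k l n m).filter fun x => RowCovered x.1 x.2.1).card ≤
      (coverFamilies k l n).card * 2 * l := by
  have h : ((markedSingletonPairs k l n m).filter fun x => RowCovered x.1 x.2.1).card ≤
      (markedRepeats k l n ×ˢ (Finset.univ : Finset (Fin l))).card := by
    -- The second coordinate records the lost element of row `r`. Using a relation avoids having to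
    -- choose it as a function.
    refine Finset.card_le_card_of_forall_subsingleton
      (fun x y => x.1 x.2.1 = {y.2} ∧ y.1 = ⟨copyRow x.1 x.2.1 x.2.2, x.2.1⟩) ?_ ?_
    · rintro ⟨A, r, r'⟩ hx
      rw [Finset.mem_filter, mem_markedSingletonPairs] at hx
      obtain ⟨⟨hA, hinj, -, hr, hr', hne⟩, hcov⟩ := hx
      obtain ⟨j, hj⟩ := Finset.card_eq_one.1 hr
      exact ⟨(⟨copyRow A r r', r⟩, j), Finset.mem_product.2
        ⟨copyRow_mem_markedRepeats hA hinj hr hr' hne hcov, Finset.mem_univ _⟩, hj, rfl⟩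
    · rintro ⟨y, j⟩ - ⟨A, r, s⟩ ⟨hx, hj, hy⟩ ⟨A', r', s'⟩ ⟨hx', hj', hy'⟩
      rw [Finset.mem_filter, mem_markedSingletonPairs] at hx hx'
      simp only at hj hj' hy hy'
      rw [hy] at hy'
      simp only [Sigma.mk.injEq, heq_eq_eq] at hy'
      obtain ⟨h, rfl⟩ := hy'
      obtain ⟨rfl, rfl⟩ := eq_of_copyRow_eq hx.1.2.1 hx.1.2.2.2.2.2 hx'.1.2.2.2.2.2
        (hj.trans hj'.symm) h
      rfl
  rw [Finset.card_product, Finset.card_univ, Fintype.card_fin] at h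
  exact h.trans (Nat.mul_le_mul_right _ (card_markedRepeats_le k l n))

open Classical in
theorem card_uncovered_markedSingletonPairs_le (k l n m : ℕ) :
    ((markedSingletonPairs k (l + 1) n m).filter fun x => ¬ RowCovered x.1 x.2.1).card ≤
      (coverFamilies k l n).card * 2 * (l + 1) := by
  have h : ((markedSingletonPairs k (l + 1) n m).filter fun x => ¬ RowCovered x.1 x.2.1).card ≤
      (markedRepeats k l n ×ˢ (Finset.univ : Finset (Fin (l + 1)))).card := by
    -- Here the recorded element also tells where the deleted column has to be reinserted.
    refine Finset.card_le_card_of_forall_subsingleton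
      (fun x y => x.1 x.2.1 = {y.2} ∧ (∀ i, i ≠ x.2.1 → y.2 ∉ x.1 i) ∧
        y.1 = ⟨deleteColumn y.2 (copyRow x.1 x.2.1 x.2.2), x.2.1⟩) ?_ ?_
    · rintro ⟨A, r, r'⟩ hx
      rw [Finset.mem_filter, mem_markedSingletonPairs] at hx
      obtain ⟨⟨hA, hinj, -, hr, hr', hne⟩, hcov⟩ := hx
      obtain ⟨j, hj⟩ := Finset.card_eq_one.1 hr
      have hcol : ∀ i, i ≠ r → j ∉ A i := by
        simp only [RowCovered] at hcov
        push Not at hcov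
        obtain ⟨c, hc, hcov⟩ := hcov
        rw [hj, Finset.mem_singleton] at hc
        exact hc ▸ hcov
      exact ⟨(⟨deleteColumn j (copyRow A r r'), r⟩, j), Finset.mem_product.2
        ⟨deleteColumn_copyRow_mem_markedRepeats hA hinj hj hr' hne hcol, Finset.mem_univ _⟩,
        hj, hcol, rfl⟩
    · rintro ⟨y, j⟩ - ⟨A, r, s⟩ ⟨hx, hj, hcol, hy⟩ ⟨A', r', s'⟩ ⟨hx', hj', hcol', hy'⟩
      rw [Finset.mem_filter, mem_markedSingletonPairs] at hx hx'
      simp only at hj hj' hy hy' hcol hcol'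
      rw [hy] at hy'
      simp only [Sigma.mk.injEq, heq_eq_eq] at hy'
      obtain ⟨h, rfl⟩ := hy'
      have hs := hx.1.2.2.2.2.2
      have hs' := hx'.1.2.2.2.2.2
      obtain ⟨rfl, rfl⟩ := eq_of_copyRow_eq hx.1.2.1 hs hs' (hj.trans hj'.symm)
        (funext fun i => deleteColumn_injective (notMem_copyRow hs hcol i)
          (notMem_copyRow hs' hcol' i) (congrFun h i))
      rfl
  rw [Finset.card_product, Finset.card_univ, Fintype.card_fin] at h
  exact h.trans (Nat.mul_le_mul_right _ (card_markedRepeats_le k l n))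

theorem card_many_singletonRows_mul_le (k l n m : ℕ) :
    (manySingletonFamilies k (l + 1) n m).card * ((m + 1) * m) ≤
      2 * (l + 1) * ((coverFamilies k (l + 1) n).card + (coverFamilies k l n).card) := by
  classical
  have h1 := card_manySingletonFamilies_mul_le k (l + 1) n m
  have h2 := card_covered_markedSingletonPairs_le k (l + 1) n m
  have h3 := card_uncovered_markedSingletonPairs_le k l n m
  rw [← Finset.card_filter_add_card_filter_not (s := markedSingletonPairs k (l + 1) n m)
    (fun x => RowCovered x.1 x.2.1)] at h1
  calc _ ≤ _ := h1.trans (add_le_add h2 h3)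
    _ = _ := by ring

theorem manySingletonFamilies_zero (k n m : ℕ) : manySingletonFamilies k 0 n m = ∅ := by
  refine Finset.filter_eq_empty_iff.2 fun A _ h => ?_
  obtain ⟨i, hi⟩ := Finset.card_pos.1 ((Nat.zero_le m).trans_lt h.2)
  obtain ⟨j, -⟩ := Finset.card_eq_one.1 (mem_singletonRows.1 hi)
  exact j.elim0

/-! ### From families of sets back to matrices -/

/-- Zero-one matrices correspond to the families of their row supports. -/
def rowSupports (k l : ℕ) : ZeroOneMatrix k l ≃ (Fin k → Finset (Fin l)) where
  toFun A i := Finset.univ.filter fun j => A i j = 1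
  invFun B := fun i j => if j ∈ B i then 1 else 0
  left_inv A := by
    ext i j
    have : A i j = 0 ∨ A i j = 1 := by omega
    rcases this with h | h <;> simp [h]
  right_inv B := by
    ext i j
    simp

theorem mem_rowSupports {k l : ℕ} {A : ZeroOneMatrix k l} {i : Fin k} {j : Fin l} :
    j ∈ rowSupports k l A i ↔ A i j = 1 := by
  change j ∈ Finset.univ.filter (fun j => A i j = 1) ↔ _
  simp

theorem numOnes_eq_sum_rowSupports {k l : ℕ} (A : ZeroOneMatrix k l) :
    numOnes A = ∑ i, (rowSupports k l A i).card := by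
  rw [numOnes, ← Finset.univ_product_univ, Finset.card_filter, Finset.sum_product]
  exact Finset.sum_congr rfl fun i _ => (Finset.card_filter _ _).symm

theorem rowSupports_mem_coverFamilies {k l n : ℕ} {A : ZeroOneMatrix k l} :
    rowSupports k l A ∈ coverFamilies k l n ↔ IsIncidenceMatrix A ∧ numOnes A = n := by
  simp only [mem_coverFamilies, Finset.Nonempty, mem_rowSupports, IsIncidenceMatrix,
    numOnes_eq_sum_rowSupports, and_assoc]

theorem rowSupports_injective_iff {k l : ℕ} {A : ZeroOneMatrix k l} :
    Function.Injective (rowSupports k l A) ↔ NoRepeatedRows A := by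
  have h : ∀ i i', rowSupports k l A i = rowSupports k l A i' ↔ A i = A i' := by
    intro i i'
    refine ⟨fun h => funext fun j => ?_, fun h => Finset.ext fun j => by
      rw [mem_rowSupports, h, mem_rowSupports]⟩
    have hj : A i j = 1 ↔ A i' j = 1 := by rw [← mem_rowSupports, h, mem_rowSupports]
    omega
  refine ⟨fun hinj i i' hne heq => hne (hinj ((h i i').2 heq)), fun hA i i' heq => ?_⟩
  by_contra hne
  exact hA i i' hne ((h i i').1 heq)

theorem ncard_eq_sum_card_rowSupports {N : ℕ} {S : Set (Σ k l : ℕ, ZeroOneMatrix k l)}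
    {Q : ∀ k l : ℕ, Finset (Fin k → Finset (Fin l))}
    (h : ∀ k l A, (⟨k, l, A⟩ : Σ k l : ℕ, ZeroOneMatrix k l) ∈ S ↔
      k < N ∧ l < N ∧ rowSupports k l A ∈ Q k l) :
    S.ncard = ∑ k ∈ Finset.range N, ∑ l ∈ Finset.range N, (Q k l).card := by
  let e : (Σ k l : ℕ, ZeroOneMatrix k l) ≃ Σ k l : ℕ, (Fin k → Finset (Fin l)) :=
    Equiv.sigmaCongrRight fun k => Equiv.sigmaCongrRight fun l => rowSupports k l
  have himage : e '' S =
      ((Finset.range N).sigma fun k => (Finset.range N).sigma fun l => Q k l) := by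
    rw [Equiv.image_eq_preimage_symm]
    ext x
    obtain ⟨⟨k, l, A⟩, rfl⟩ := e.surjective x
    rw [Set.mem_preimage, Equiv.symm_apply_apply, h]
    simp [e]
  rw [← Set.ncard_image_of_injective S e.injective, himage, Set.ncard_coe_finset,
    Finset.card_sigma]
  exact Finset.sum_congr rfl fun k _ => Finset.card_sigma _ _

/-- Neither dimension exceeds `n`, so any bound `N` beyond `n` works. The freedom is needed because
splitting adds a row. -/
theorem F1111_eq_sum {n N : ℕ} (hN : n < N) :
    F1111 n = ∑ k ∈ Finset.range N, ∑ l ∈ Finset.range N, (coverFamilies k l n).card := by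
  refine ncard_eq_sum_card_rowSupports fun k l A => ?_
  rw [rowSupports_mem_coverFamilies]
  refine ⟨fun h => ⟨?_, ?_, h⟩, fun h => h.2.2⟩
  · exact (h.1.rows_le.trans_eq h.2).trans_lt hN
  · exact (h.1.cols_le.trans_eq h.2).trans_lt hN

open Classical in
theorem F1011_eq_sum {n N : ℕ} (hN : n < N) :
    F1011 n = ∑ k ∈ Finset.range N, ∑ l ∈ Finset.range N,
      ((coverFamilies k l n).filter fun A => Function.Injective A).card := by
  refine ncard_eq_sum_card_rowSupports fun k l A => ?_
  rw [Finset.mem_filter, rowSupports_mem_coverFamilies, rowSupports_injective_iff]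
  refine ⟨fun h => ⟨?_, ?_, h⟩, fun h => h.2.2⟩
  · exact (h.1.1.rows_le.trans_eq h.1.2).trans_lt hN
  · exact (h.1.1.cols_le.trans_eq h.1.2).trans_lt hN

/-! ### Summation over all sizes and asymptotics -/

theorem sum_few_singletonRows_mul_le (n m : ℕ) :
    (∑ k ∈ Finset.range (n + 1), ∑ l ∈ Finset.range (n + 1),
      ((coverFamilies k l n).filter fun A => (singletonRows A).card ≤ m).card) * (n - m) ≤
      (m + 2) * F1111 n := by
  calc _ ≤ ∑ k ∈ Finset.range (n + 1), ∑ l ∈ Finset.range (n + 1),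
        (m + 2) * (coverFamilies (k + 1) l n).card := by
        simp only [Finset.sum_mul]
        exact Finset.sum_le_sum fun k _ => Finset.sum_le_sum fun l _ =>
          card_few_singletonRows_mul_le k l n m
    _ ≤ ∑ k ∈ Finset.range (n + 1), ∑ l ∈ Finset.range (n + 2),
        (m + 2) * (coverFamilies (k + 1) l n).card := by
        gcongr
        omega
    _ ≤ ∑ k ∈ Finset.range (n + 2), ∑ l ∈ Finset.range (n + 2),
        (m + 2) * (coverFamilies k l n).card := by
        rw [Finset.sum_range_succ' _ (n + 1)]
        exact Nat.le_add_right _ _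
    _ = _ := by
        simp only [← Finset.mul_sum]
        rw [← F1111_eq_sum (by omega)]

theorem sum_many_singletonRows_mul_le (n m : ℕ) :
    (∑ k ∈ Finset.range (n + 1), ∑ l ∈ Finset.range (n + 1),
      (manySingletonFamilies k l n m).card) * ((m + 1) * m) ≤ 4 * n * F1111 n := by
  have hrow : ∀ k, (∑ l ∈ Finset.range (n + 1), (manySingletonFamilies k l n m).card) *
      ((m + 1) * m) ≤ 4 * n * ∑ l ∈ Finset.range (n + 1), (coverFamilies k l n).card := by
    intro k
    -- The term with no columns vanishes; the others have the form `l + 1 ≤ n`, as the column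
    -- deletion requires.
    rw [Finset.sum_range_succ' _ n, manySingletonFamilies_zero, Finset.card_empty, add_zero,
      Finset.sum_mul]
    calc _ ≤ ∑ l ∈ Finset.range n,
          2 * n * ((coverFamilies k (l + 1) n).card + (coverFamilies k l n).card) := by
          refine Finset.sum_le_sum fun l hl => (card_many_singletonRows_mul_le k l n m).trans ?_
          gcongr
          exact Finset.mem_range.1 hl
      _ = 2 * n * (∑ l ∈ Finset.range n, (coverFamilies k (l + 1) n).card +
          ∑ l ∈ Finset.range n, (coverFamilies k l n).card) := by
          rw [← Finset.mul_sum, Finset.sum_add_distrib]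
      _ ≤ 2 * n * (∑ l ∈ Finset.range (n + 1), (coverFamilies k l n).card +
          ∑ l ∈ Finset.range (n + 1), (coverFamilies k l n).card) := by
          refine Nat.mul_le_mul_left _ (add_le_add ?_ ?_)
          · rw [Finset.sum_range_succ' _ n]
            exact Nat.le_add_right _ _
          · rw [Finset.sum_range_succ _ n]
            exact Nat.le_add_right _ _
      _ = _ := by ring
  rw [F1111_eq_sum n.lt_succ_self, Finset.sum_mul, Finset.mul_sum]
  exact Finset.sum_le_sum fun k _ => hrow k

theorem F1011_le_few_add_many (n m : ℕ) :
    F1011 n ≤ (∑ k ∈ Finset.range (n + 1), ∑ l ∈ Finset.range (n + 1),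
        ((coverFamilies k l n).filter fun A => (singletonRows A).card ≤ m).card) +
      ∑ k ∈ Finset.range (n + 1), ∑ l ∈ Finset.range (n + 1),
        (manySingletonFamilies k l n m).card := by
  classical
  rw [F1011_eq_sum n.lt_succ_self]
  simp only [← Finset.sum_add_distrib]
  refine Finset.sum_le_sum fun k _ => Finset.sum_le_sum fun l _ => ?_
  refine (Finset.card_le_card fun A hA => ?_).trans (Finset.card_union_le _ _)
  rw [Finset.mem_filter] at hA
  rw [Finset.mem_union, manySingletonFamilies, Finset.mem_filter, Finset.mem_filter]
  rcases le_or_gt (singletonRows A).card m with h | h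
  · exact Or.inl ⟨hA.1, h⟩
  · exact Or.inr ⟨hA.1, hA.2, h⟩

theorem F1011_le_mul_F1111 {n m : ℕ} (hm : 0 < m) (hmn : m < n) :
    (F1011 n : ℝ) ≤ ((m + 2) / (n - m) + 4 * n / ((m + 1) * m)) * F1111 n := by
  have h := F1011_le_few_add_many n m
  have h1 := sum_few_singletonRows_mul_le n m
  have h2 := sum_many_singletonRows_mul_le n m
  generalize (∑ k ∈ Finset.range (n + 1), ∑ l ∈ Finset.range (n + 1),
    ((coverFamilies k l n).filter fun A => (singletonRows A).card ≤ m).card) = a at h h1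
  generalize (∑ k ∈ Finset.range (n + 1), ∑ l ∈ Finset.range (n + 1),
    (manySingletonFamilies k l n m).card) = b at h h2
  have hm' : (0 : ℝ) < m := by exact_mod_cast hm
  have hmn' : (0 : ℝ) < n - m := sub_pos.2 (by exact_mod_cast hmn)
  have h' : (F1011 n : ℝ) ≤ a + b := by exact_mod_cast h
  have h1' : (a : ℝ) * (n - m) ≤ (m + 2) * F1111 n := by
    rw [← Nat.cast_sub hmn.le]
    exact_mod_cast h1
  have h2' : (b : ℝ) * ((m + 1) * m) ≤ 4 * n * F1111 n := by exact_mod_cast h2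
  refine h'.trans ?_
  rw [add_mul, div_mul_eq_mul_div, div_mul_eq_mul_div]
  exact add_le_add ((le_div_iff₀ hmn').2 h1') ((le_div_iff₀ (by positivity)).2 h2')

theorem add_two_div_add_le {x y K : ℝ} (hK : 2 ≤ K) (hx : 0 < x) (hy : y ≤ x / K)
    (hy' : x / (2 * K) ≤ y) :
    (y + 2) / (x - y) + 4 * x / ((y + 1) * y) ≤ 2 / K + (4 + 16 * K ^ 2) / x := by
  have hK0 : 0 < K := by linarith
  -- Gives `x - y ≥ x / 2` for the first denominator.
  have hhalf : x / K ≤ x / 2 := by gcongr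
  have hpos : 0 < x / (2 * K) := by positivity
  have h1 : (y + 2) / (x - y) ≤ 2 / K + 4 / x := by
    calc (y + 2) / (x - y) ≤ (x / K + 2) / (x / 2) := by
          apply div_le_div₀ <;> first | positivity | linarith
      _ = _ := by field_simp; ring
  have h2 : 4 * x / ((y + 1) * y) ≤ 16 * K ^ 2 / x := by
    calc 4 * x / ((y + 1) * y) ≤ 4 * x / (x / (2 * K) * (x / (2 * K))) := by
          have hy1 : x / (2 * K) ≤ y + 1 := by linarith
          have hy0 : 0 ≤ y + 1 := hpos.le.trans hy1
          gcongr
      _ = _ := by field_simp; ring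
  rw [add_div 4]
  linarith

theorem mainTheorem2 :
    (fun n : ℕ => (F1011 n : ℝ)) =o[atTop] (fun n : ℕ => (F1111 n : ℝ)) := by
  rw [isLittleO_iff]
  intro c hc
  -- `4 / c` makes the main term `2 / K` less than `c / 2`; the error term gets the other half.
  obtain ⟨K, hK⟩ := exists_nat_gt (max 2 (4 / c))
  have hK2 : (2 : ℝ) < K := (le_max_left _ _).trans_lt hK
  have hKc : 2 / (K : ℝ) < c / 2 := by
    have := (le_max_right _ _).trans_lt hK
    rw [div_lt_iff₀ hc] at this
    rw [div_lt_iff₀ (by linarith)]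
    linarith
  have hK2' : 2 < K := by exact_mod_cast hK2
  have hlim : Tendsto (fun n : ℕ => (4 + 16 * (K : ℝ) ^ 2) / n) atTop (nhds 0) :=
    tendsto_const_div_atTop_nhds_zero_nat _
  filter_upwards [hlim.eventually_lt_const (half_pos hc), eventually_ge_atTop (2 * K)]
    with n hn hnK
  have hn0 : 0 < n := by omega
  have hm : 2 ≤ n / K := (Nat.le_div_iff_mul_le (by omega)).2 hnK
  have hmn : n / K < n := Nat.div_lt_self hn0 (by omega)
  have hle : ((n / K : ℕ) : ℝ) ≤ n / K := Nat.cast_div_le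
  -- Rounding down loses at most a factor two, since the quotient `n / K` is at least one.
  have hge : (n : ℝ) / (2 * K) ≤ (n / K : ℕ) := by
    have hlt : n < K * (n / K + 1) := Nat.lt_mul_div_succ n (by omega)
    have hle : n ≤ n / K * (2 * K) := by nlinarith
    rw [div_le_iff₀ (by linarith)]
    exact_mod_cast hle
  rw [Real.norm_natCast, Real.norm_natCast]
  refine (F1011_le_mul_F1111 (by omega) hmn).trans ?_
  gcongr
  have := add_two_div_add_le hK2.le (by exact_mod_cast hn0) hle hge
  linarith
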